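/- **Setting.** Let $G$ be a locally compact Hausdorff group with identity $e$ and let $A$ be a C*-algebra. A *C\*-partial action* $\alpha=(\{A_t\}_{t\in G},\{\alpha_t\}_{t\in G})$ of $G$ on $A$ consists of closed two-sided ideals $A_t$ of $A$ and *-isomorphisms $\alpha_t:A_{t^{-1}}\to A_t$ such that $A_e=A$, $\alpha_e=\mathrm{id}_A$, $\alpha_t(A_{t^{-1}}\cap A_s)=A_t\cap A_{ts}$, $\alpha_{st}=\alpha_s\circ\alpha_t$ on $A_{t^{-1}s^{-1}}\cap A_{t^{-1}}$, and the map $\{(t,a)\in G\times A: a\in A_{t^{-1}}\}\to A$, $(t,a)\mapsto\alpha_t(a)$, is continuous. It is *global* if $A_t=A$ for all $t$. Write $\alpha_d$ for $\alpha$ regarded as a partial action of the discrete group $G_d$. A *C\*-enveloping pair* of $\alpha$ is a pair $(\mu,\beta)$ where $\beta$ is a (continuous) global C*-action of $G$ on a C*-algebra $B$ and $\mu:A\to B$ is an injective *-homomorphism such that $\mu(A)$ is a two-sided ideal of $B$, $\mu(A_t)=\mu(A)\cap\beta_t(\mu(A))$ for all $t\in G$, $\mu(\alpha_t(a))=\beta_t(\mu(a))$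 for all $t\in G$ and $a\in A_{t^{-1}}$, and the linear span of $\bigcup_{t\in G}\beta_t(\mu(A))$ is dense in $B$. $\alpha_d$ has *property (NS)* if for all $a,b\in A$, all $t\in G$ and every approximate unit $(u_i)$ of $A_{t^{-1}}$ (a net of positive contractions in $A_{t^{-1}}$ with $u_ix\to x$ and $xu_i\to x$ for all $x\in A_{t^{-1}}$) the net $(\alpha_t(u_ia)b)_i$ converges in norm. An *enveloping family of functions* for $\alpha_d$ is a family $(F_t)_{t\in G}$ of bilinear maps $F_t:A\times A\to A_t$ such that, for all $s,t\in G$ and $a,b,c\in A$: 1. $F_e(a,b)=ab$; 2. $F_t(a,bc)=F_t(a,b)c$, $\ \alpha_t(F_{t^{-1}}(ab,c))=a\,\alpha_t(F_{t^{-1}}(b,c))$, $\ aF_t(b,c)=\alpha_t(F_{t^{-1}}(a,b))c$; 3. $F_t(F_s(a,b),c)=F_{ts}(a,F_t(b,c))$ and $F_t(\alpha_{s^{-1}}[F_s(a,b)],c)=F_t(a,F_{ts^{-1}}(b,c))$; 4. $a=0$ if and only if $F_r(a,d)=F_r(d,a)=0$ for all $r\in G$ and $d\in A$; 5. if $a\in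 A_{t^{-1}}$, then $F_{st}(a,b)=F_s(\alpha_t(a),b)$ and $\alpha_{st}(F_{t^{-1}s^{-1}}(b,a))=\alpha_s(F_{s^{-1}}(b,\alpha_t(a)))$; 6. if $F_r(a,d)=F_{rt}(b,d)$, $F_{t^{-1}r}(d,b)\in A_{t^{-1}}$ and $F_r(d,a)=\alpha_t(F_{t^{-1}r}(d,b))$ for all $r\in G$ and $d\in A$, then $a\in A_t$. **Theorem.** Let $\alpha$ be a C*-partial action of a locally compact Hausdorff group $G$ on a C*-algebra $A$. If $\alpha_d$ has property (NS), then $\alpha_d$ has exactly one enveloping family of functions. Moreover, $\alpha$ has a C*-enveloping pair if and only if 1. $\alpha_d$ has property (NS), and 2. the unique enveloping family of functions $(F_t)_{t\in G}$ for $\alpha_d$ satisfies, for every $a\in A$, $$\lim_{t\to e}\ \sup\{\|F_{rt}(a,b)-F_r(a,b)\| : b\in A,\ \|b\|\le 1,\ r\in G\}=0 .$$ -/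

import Mathlib

open Filter Topology

universe u v

/-- A C*-partial action of the (abstract, i.e. discrete) group `G` on the C*-algebra `A`:
closed two-sided ideals `A_t = dom t` and *-isomorphisms `α_t = act t : A_{t⁻¹} → A_t` that form a
set-theoretic partial action. The function `act t` is total only for convenience: its values
outside `dom t⁻¹` are irrelevant and are never used. -/
structure CStarPartialAction (G : Type u) [Group G] (A : Type v) [NonUnitalCStarAlgebra A] where
  /-- The ideal `A_t`. -/
  dom : G → Submodule ℂ A
  /-- The map `α_t : A_{t⁻¹} → A_t`. -/
  act : G → A → A
  mul_mem_left : ∀ (t : G) (a x : A), x ∈ dom t → a * x ∈ dom t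
  mul_mem_right : ∀ (t : G) (a x : A), x ∈ dom t → x * a ∈ dom t
  isClosed_dom : ∀ t : G, IsClosed (dom t : Set A)
  bijOn : ∀ t : G, Set.BijOn (act t) (dom t⁻¹) (dom t)
  dom_one : dom 1 = ⊤
  act_one : ∀ a : A, act 1 a = a
  image_inter : ∀ s t : G,
    act t '' ((dom t⁻¹ : Set A) ∩ dom s) = (dom t : Set A) ∩ dom (t * s)
  act_mul : ∀ (s t : G) (x : A), x ∈ dom (t⁻¹ * s⁻¹) → x ∈ dom t⁻¹ →
    act (s * t) x = act s (act t x)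
  map_add : ∀ (t : G) (x y : A), x ∈ dom t⁻¹ → y ∈ dom t⁻¹ →
    act t (x + y) = act t x + act t y
  map_smul : ∀ (t : G) (c : ℂ) (x : A), x ∈ dom t⁻¹ → act t (c • x) = c • act t x
  map_mul : ∀ (t : G) (x y : A), x ∈ dom t⁻¹ → y ∈ dom t⁻¹ →
    act t (x * y) = act t x * act t y
  map_star : ∀ (t : G) (x : A), x ∈ dom t⁻¹ → act t (star x) = star (act t x)

namespace CStarPartialAction

/-- The action is global if `A_t = A` for all `t`. -/
def IsGlobal {G : Type*} [Group G] {A : Type*} [NonUnitalCStarAlgebra A]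
    (α : CStarPartialAction G A) : Prop :=
  ∀ t : G, α.dom t = ⊤

/-- Continuity of `{(t, a) ∈ G × A : a ∈ A_{t⁻¹}} → A, (t, a) ↦ α_t(a)`. This is what distinguishes
a C*-partial action of a topological group `G` from one of the discrete group `G_d`. -/
def IsContinuous {G : Type*} [Group G] [TopologicalSpace G] {A : Type*} [NonUnitalCStarAlgebra A]
    (α : CStarPartialAction G A) : Prop :=
  ContinuousOn (fun p : G × A => α.act p.1 p.2) {p : G × A | p.2 ∈ α.dom p.1⁻¹}

/-- `(μ, β)` is a C*-enveloping pair of `α` (discrete group): `β` is a global C*-action on `B`, `μ`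
is an isomorphism of `α` onto the restriction of `β` to the ideal `μ(A)` (the restriction has
domains `μ(A) ∩ β_t(μ(A))`), and the linear span of `⋃ t, β_t(μ(A))` is dense in `B`. -/
structure IsCStarEnvelopingPair {G : Type*} [Group G] {A : Type*} [NonUnitalCStarAlgebra A]
    {B : Type*} [NonUnitalCStarAlgebra B]
    (α : CStarPartialAction G A) (μ : A →⋆ₙₐ[ℂ] B) (β : CStarPartialAction G B) : Prop where
  isGlobal : β.IsGlobal
  injective : Function.Injective μ
  mul_mem_left : ∀ (b : B) (a : A), b * μ a ∈ Set.range μ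
  mul_mem_right : ∀ (b : B) (a : A), μ a * b ∈ Set.range μ
  image_dom : ∀ t : G, μ '' (α.dom t) = Set.range μ ∩ β.act t '' Set.range μ
  map_act : ∀ (t : G) (a : A), a ∈ α.dom t⁻¹ → μ (α.act t a) = β.act t (μ a)
  dense_span : Dense (Submodule.span ℂ (⋃ t : G, β.act t '' Set.range μ) : Set B)

/-- The partial action `α` of the topological group `G` has a C*-enveloping pair `(μ, β)`, with `β`
a continuous global C*-action of `G`. -/
def HasCStarEnvelopingPair {G : Type u} [Group G] [TopologicalSpace G]
    {A : Type v} [NonUnitalCStarAlgebra A] (α : CStarPartialAction G A) : Prop :=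
  ∃ (B : Type (max u v)) (_ : NonUnitalCStarAlgebra B) (μ : A →⋆ₙₐ[ℂ] B)
    (β : CStarPartialAction G B), β.IsContinuous ∧ α.IsCStarEnvelopingPair μ β

/-- The net `u` is an approximate unit of the ideal `I`: it consists of positive elements of `I` of
norm at most one, and `u_i x → x` and `x u_i → x` for all `x ∈ I`. -/
structure IsApproxUnit {A : Type*} [NonUnitalCStarAlgebra A] (I : Submodule ℂ A)
    {ι : Type*} [Preorder ι] (u : ι → A) : Prop where
  mem : ∀ i, u i ∈ I
  positive : ∀ i, ∃ y : A, u i = star y * y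
  norm_le_one : ∀ i, ‖u i‖ ≤ 1
  tendsto_mul_right : ∀ x ∈ I, Tendsto (fun i => u i * x) atTop (𝓝 x)
  tendsto_mul_left : ∀ x ∈ I, Tendsto (fun i => x * u i) atTop (𝓝 x)

/-- Property (NS): for all `a, b ∈ A`, `t ∈ G` and every approximate unit `(u_i)` of `A_{t⁻¹}`, the
net `α_t(u_i a) b` converges. -/
def PropertyNS {G : Type u} [Group G] {A : Type v} [NonUnitalCStarAlgebra A]
    (α : CStarPartialAction G A) : Prop :=
  ∀ (a b : A) (t : G) (ι : Type v) [Preorder ι] [IsDirectedOrder ι] [Nonempty ι] (u : ι → A),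
    IsApproxUnit (α.dom t⁻¹) u →
      ∃ x : A, Tendsto (fun i => α.act t (u i * a) * b) atTop (𝓝 x)

/-- `(F_t)` is an enveloping family of functions for `α`; bilinearity of `F_t` is part of the type
of `F`. In `mem_dom_of_eq` the equation `F_s(c, a) = α_t(F_{t⁻¹s}(c, b))` includes that its
right-hand side is defined. -/
structure IsEnvelopingFamily {G : Type*} [Group G] {A : Type*} [NonUnitalCStarAlgebra A]
    (α : CStarPartialAction G A) (F : G → A →ₗ[ℂ] A →ₗ[ℂ] A) : Prop where
  mem_dom : ∀ (t : G) (a b : A), F t a b ∈ α.dom t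
  one_eq_mul : ∀ a b : A, F 1 a b = a * b
  apply_mul : ∀ (t : G) (a b c : A), F t a (b * c) = F t a b * c
  act_mul_apply : ∀ (t : G) (a b c : A),
    α.act t (F t⁻¹ (a * b) c) = a * α.act t (F t⁻¹ b c)
  mul_apply : ∀ (t : G) (a b c : A), a * F t b c = α.act t (F t⁻¹ a b) * c
  apply_apply : ∀ (s t : G) (a b c : A), F t (F s a b) c = F (t * s) a (F t b c)
  apply_act_apply : ∀ (s t : G) (a b c : A),
    F t (α.act s⁻¹ (F s a b)) c = F t a (F (t * s⁻¹) b c)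
  eq_zero_iff : ∀ a : A, a = 0 ↔ ∀ (t : G) (b : A), F t a b = 0 ∧ F t b a = 0
  apply_act : ∀ (s t : G) (a b : A), a ∈ α.dom t⁻¹ → F (s * t) a b = F s (α.act t a) b
  act_apply_act : ∀ (s t : G) (a b : A), a ∈ α.dom t⁻¹ →
    α.act (s * t) (F (t⁻¹ * s⁻¹) b a) = α.act s (F s⁻¹ b (α.act t a))
  mem_dom_of_eq : ∀ (t : G) (a b : A),
    (∀ (s : G) (c : A), F s a c = F (s * t) b c ∧
      F (t⁻¹ * s) c b ∈ α.dom t⁻¹ ∧ F s c a = α.act t (F (t⁻¹ * s) c b)) →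
    a ∈ α.dom t

end CStarPartialAction

/-! In any enveloping action `β`, with `A` regarded as an ideal of `B`, the product `β_t(a) b` lies
in `A_t`, and multiplying it by `α_t(v)` gives `α_t(v a) b`. `IsActMul` takes this identity as a
definition inside `A`. Elements of `A_t` are separated by left multiplication by `A_t`, so such a
product is unique (`IsActMul.unique`). Property (NS) says exactly that all of these products exist
(`propertyNS_iff`). A few of the axioms of an enveloping family already force `F_t(a, b) = β_t(a) b`
(`IsEnvelopingFamily.isActMul`), whence uniqueness.

For existence, the products make `β_r(a)` a multiplier of `A`, and `a ↦ (r ↦ β_r(a))` embeds `A` in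
the bounded functions from `G` to the multiplier algebra. There `G` acts by right translation. The
associativity law `IsActMul.comp` makes `A` an ideal of the C*-algebra generated by its translates,
so (NS) alone yields an enveloping pair of the discrete group. In `B` the axioms of an enveloping
family become identities between products, which injectivity of `μ` carries back to `A`.

Topology enters only at the end. In this model the supremum in condition 2 bounds `‖β_t(a) - a‖`,
and in any enveloping pair it is bounded by that norm. Hence condition 2 amounts to strong
continuity at the identity on `A`, which the group law and density spread to all of `G × B`. -/

/-! ### Closed ideals and approximate units of C*-algebras. -/

/-- Bernoulli gives `n s ≤ (1 + s)^n`, and `(1 - s)^n (1 + s)^n = (1 - s²)^n ≤ 1`. -/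
lemma mul_one_sub_pow_le {s : ℝ} (h0 : 0 ≤ s) (h1 : s ≤ 1) (n : ℕ) :
    s * (1 - s) ^ n * n ≤ 1 := by
  have hb : 1 + (n : ℝ) * s ≤ (1 + s) ^ n := one_add_mul_le_pow (by linarith) n
  have hp : 0 ≤ (1 - s) ^ n := pow_nonneg (by linarith) n
  calc s * (1 - s) ^ n * n = (1 - s) ^ n * (n * s) := by ring
    _ ≤ (1 - s) ^ n * (1 + s) ^ n := by gcongr; linarith
    _ = (1 - s ^ 2) ^ n := by rw [← mul_pow]; ring
    _ ≤ 1 := pow_le_one₀ (by nlinarith) (by nlinarith)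

/-- With `h = x⋆ x`, the C*-identity turns the squared norm into that of `h (1 - c h)^(2n)`.
Functional calculus then reduces the bound to the preceding scalar estimate. It shows that `x (1 - c
h)^n` tends to zero when `c > 0`. -/
lemma norm_mul_one_sub_star_mul_self_pow_le {A : Type*} [CStarAlgebra A] (x : A) (c : ℝ)
    (hc : 0 ≤ c) (hcx : c * ‖star x * x‖ ≤ 1) (n : ℕ) :
    c * ‖x * (1 - c • (star x * x)) ^ n‖ ^ 2 * (2 * n : ℕ) ≤ 1 := by
  set h := star x * x with hh
  have hsa : IsSelfAdjoint h := IsSelfAdjoint.star_mul_self x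
  have hp : star (x * (1 - c • h) ^ n) * (x * (1 - c • h) ^ n)
      = Polynomial.aeval h
          ((Polynomial.X : Polynomial ℝ) * (1 - Polynomial.C c * Polynomial.X) ^ (2 * n)) := by
    have hcomm : Commute h (1 - c • h) :=
      (Commute.one_right h).sub_right ((Commute.refl h).smul_right c)
    have h1 : star ((1 - c • h) ^ n) = (1 - c • h) ^ n := by
      simp [star_smul, hsa.star_eq]
    simp only [star_mul, h1, map_mul, Polynomial.aeval_X, map_pow, map_sub, map_one,
      Polynomial.aeval_C]
    rw [← Algebra.smul_def, two_mul, pow_add, mul_assoc, ← mul_assoc (star x), ← hh, ← mul_assoc,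
      ← (hcomm.pow_right n).eq, mul_assoc]
  rcases Nat.eq_zero_or_pos n with rfl | hn
  · simp
  rw [sq, ← CStarRing.norm_star_mul_self, hp, ← cfc_polynomial _ h]
  have hn' : (0 : ℝ) < (2 * n : ℕ) := by positivity
  rw [← le_div_iff₀ hn']
  rcases hc.eq_or_lt with rfl | hc
  · simp
  rw [mul_comm, ← le_div_iff₀ hc]
  refine norm_cfc_le (by positivity) fun t ht => ?_
  have ht0 : 0 ≤ t := spectrum_star_mul_self_nonneg t ht
  have ht1 : t ≤ ‖h‖ := by
    have := spectrum.norm_le_norm_mul_of_mem ht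
    rcases subsingleton_or_nontrivial A with hA | hA
    · simp [spectrum.of_subsingleton] at ht
    · simpa [abs_of_nonneg ht0] using this
  have hct : c * t ≤ 1 := (mul_le_mul_of_nonneg_left ht1 hc.le).trans hcx
  have hct0 : 0 ≤ c * t := by positivity
  have hpow : (0 : ℝ) ≤ (1 - c * t) ^ (2 * n) := pow_nonneg (sub_nonneg.2 hct) _
  have hmain := mul_one_sub_pow_le hct0 hct (2 * n)
  have hval : Polynomial.eval t
      ((Polynomial.X : Polynomial ℝ) * (1 - Polynomial.C c * Polynomial.X) ^ (2 * n))
      = t * (1 - c * t) ^ (2 * n) := by simp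
  rw [hval, Real.norm_of_nonneg (mul_nonneg ht0 hpow),
    le_div_iff₀ hc, le_div_iff₀ hn']
  calc t * (1 - c * t) ^ (2 * n) * c * (2 * n : ℕ)
      = c * t * (1 - c * t) ^ (2 * n) * (2 * n : ℕ) := by ring
    _ ≤ 1 := hmain

section Ideal

variable {A : Type*} [NonUnitalCStarAlgebra A]

/-- A closed left ideal of a C*-algebra contains `x` as soon as it contains `x⋆ x`. -/
lemma Submodule.mem_of_star_mul_self_mem (I : Submodule ℂ A) (hI : IsClosed (I : Set A))
    (hl : ∀ a, ∀ y ∈ I, a * y ∈ I) {x : A} (hx : star x * x ∈ I) : x ∈ I := by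
  set c : ℝ := (‖star x * x‖ + 1)⁻¹ with hc
  have hc0 : 0 < c := by positivity
  have hcx : c * ‖star x * x‖ ≤ 1 := by
    rw [hc, inv_mul_le_iff₀ (by positivity)]; linarith
  let X : Unitization ℂ A := x
  -- This is `x (1 - c x⋆ x)^n`, written as an iteration that stays in `A`. Each step changes it by
  -- an element of `I`, so `x - y n` lies in `I`.
  let y : ℕ → A := fun n => (fun z => z - (c : ℂ) • (z * (star x * x)))^[n] x
  have hyX : ∀ n, ((y n : A) : Unitization ℂ A) = X * (1 - c • (star X * X)) ^ n := by
    intro n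
    induction n with
    | zero => simp [y, X]
    | succ n ih =>
      rw [pow_succ, ← mul_assoc, ← ih, mul_sub, mul_one, mul_smul_comm]
      simp only [y, Function.iterate_succ_apply', X]
      rw [Unitization.inr_sub, Unitization.inr_smul, Unitization.inr_mul, Unitization.inr_mul,
        Unitization.inr_star]
      simp
  have hyI : ∀ n, x - y n ∈ I := by
    intro n
    induction n with
    | zero => simp [y]
    | succ n ih =>
      have : x - y (n + 1) = (x - y n) + (c : ℂ) • (y n * (star x * x)) := by
        simp only [y, Function.iterate_succ_apply']; abel
      rw [this]
      exact I.add_mem ih (I.smul_mem _ (hl _ _ hx))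
  have hbound : ∀ n, c * ‖y n‖ ^ 2 * (2 * n : ℕ) ≤ 1 := by
    intro n
    rw [← Unitization.norm_inr (𝕜 := ℂ), hyX]
    refine norm_mul_one_sub_star_mul_self_pow_le X c hc0.le ?_ n
    simpa [X, ← Unitization.inr_mul, ← Unitization.inr_star, Unitization.norm_inr] using hcx
  have hy0 : Tendsto y atTop (𝓝 0) := by
    rw [tendsto_zero_iff_norm_tendsto_zero]
    have hsq : Tendsto (fun n => ‖y n‖ ^ 2) atTop (𝓝 0) := by
      refine squeeze_zero' (g := fun n : ℕ => (2 * c)⁻¹ * (n : ℝ)⁻¹)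
        (Eventually.of_forall fun n => by positivity) ?_ ?_
      · filter_upwards [eventually_gt_atTop 0] with n hn
        have hn' : (0 : ℝ) < n := by exact_mod_cast hn
        rw [← mul_inv, ← one_div, le_div_iff₀ (by positivity)]
        have := hbound n
        push_cast at this
        linarith
      · simpa using (tendsto_inv_atTop_nhds_zero_nat (𝕜 := ℝ)).const_mul (2 * c)⁻¹
    have := hsq.sqrt
    simpa [Real.sqrt_sq] using this
  have : Tendsto (fun n => x - y n) atTop (𝓝 x) := by
    simpa using tendsto_const_nhds.sub hy0
  exact hI.mem_of_tendsto this (Eventually.of_forall hyI)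

/-- A closed two-sided ideal of a C*-algebra is self-adjoint. -/
lemma Submodule.star_mem_of_isClosed_ideal (I : Submodule ℂ A) (hI : IsClosed (I : Set A))
    (hl : ∀ a, ∀ y ∈ I, a * y ∈ I) (hr : ∀ a, ∀ y ∈ I, y * a ∈ I) {x : A} (hx : x ∈ I) :
    star x ∈ I :=
  I.mem_of_star_mul_self_mem hI hl (by rw [star_star]; exact hr _ _ hx)

/-- Every closed self-adjoint subalgebra of a C*-algebra has an approximate unit. -/
lemma NonUnitalStarSubalgebra.exists_isApproxUnit {A : Type v} [NonUnitalCStarAlgebra A]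
    (S : NonUnitalStarSubalgebra ℂ A) (hS : IsClosed (S : Set A)) :
    ∃ (ι : Type v) (_ : Preorder ι) (_ : IsDirectedOrder ι) (_ : Nonempty ι) (u : ι → A),
      CStarPartialAction.IsApproxUnit S.toSubmodule u := by
  have := hS
  let := CStarAlgebra.spectralOrder S
  have := CStarAlgebra.spectralOrderedRing S
  let ι := {x : S // 0 ≤ x ∧ ‖x‖ < 1}
  have hdir : IsDirectedOrder ι := ⟨fun x y => by
    obtain ⟨z, hz, hxz, hyz⟩ := CStarAlgebra.directedOn_nonneg_ball (A := S)
      x.1 (by simpa using x.2) y.1 (by simpa using y.2)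
    exact ⟨⟨z, by simpa using hz⟩, hxz, hyz⟩⟩
  -- The positive part of the open unit ball, indexed by itself, is a net converging along the
  -- approximate unit filter.
  have hlim : Tendsto (fun i : ι => i.1) atTop (CStarAlgebra.approximateUnit S) := by
    rw [(CStarAlgebra.hasBasis_approximateUnit S).tendsto_right_iff]
    intro x hx
    filter_upwards [eventually_ge_atTop (⟨x, hx⟩ : ι)] with i hi
    exact ⟨hi, by simpa using i.2.2.le⟩
  have hunit := CStarAlgebra.increasingApproximateUnit S
  refine ⟨ι, inferInstance, hdir, ⟨⟨0, by simp⟩⟩, fun i => (i.1 : A), fun i => i.1.2, fun i => ?_,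
    fun i => i.2.2.le, fun x hx => ?_, fun x hx => ?_⟩
  · obtain ⟨y, hy⟩ := CStarAlgebra.nonneg_iff_eq_star_mul_self.mp i.2.1
    exact ⟨y, congrArg Subtype.val hy⟩
  · exact (continuous_subtype_val.tendsto _).comp ((hunit.tendsto_mul_right ⟨x, hx⟩).comp hlim)
  · exact (continuous_subtype_val.tendsto _).comp ((hunit.tendsto_mul_left ⟨x, hx⟩).comp hlim)

end Ideal

/-! ### The products `β_t(a) b` computed inside `A`. -/

namespace CStarPartialAction

variable {G : Type u} [Group G] {A : Type v} [NonUnitalCStarAlgebra A]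
  (α : CStarPartialAction G A)

lemma mem_dom_of_star_mul_self_mem {t : G} {x : A} (hx : star x * x ∈ α.dom t) : x ∈ α.dom t :=
  (α.dom t).mem_of_star_mul_self_mem (α.isClosed_dom t) (fun a y => α.mul_mem_left t a y) hx

lemma star_mem_dom {t : G} {x : A} (hx : x ∈ α.dom t) : star x ∈ α.dom t :=
  (α.dom t).star_mem_of_isClosed_ideal (α.isClosed_dom t) (fun a y => α.mul_mem_left t a y)
    (fun a y => α.mul_mem_right t a y) hx

/-- The ideal `A_t` as a C*-subalgebra of `A`. -/
def domAlg (t : G) : NonUnitalStarSubalgebra ℂ A where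
  __ := α.dom t
  mul_mem' := fun hx _ => α.mul_mem_right t _ _ hx
  star_mem' := α.star_mem_dom

lemma act_mem {t : G} {x : A} (hx : x ∈ α.dom t⁻¹) : α.act t x ∈ α.dom t :=
  (α.bijOn t).mapsTo hx

lemma exists_act_eq {t : G} {y : A} (hy : y ∈ α.dom t) : ∃ x ∈ α.dom t⁻¹, α.act t x = y :=
  (α.bijOn t).surjOn hy

lemma act_mem_mul {s t : G} {x : A} (hx : x ∈ α.dom t⁻¹) (hxs : x ∈ α.dom s) :
    α.act t x ∈ α.dom (t * s) :=
  ((α.image_inter s t).subset ⟨x, ⟨hx, hxs⟩, rfl⟩).2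

lemma exists_act_eq_of_mem_mul {s t : G} {y : A} (hy : y ∈ α.dom t) (hys : y ∈ α.dom (t * s)) :
    ∃ x ∈ α.dom t⁻¹, x ∈ α.dom s ∧ α.act t x = y := by
  obtain ⟨x, ⟨hx, hxs⟩, h⟩ := (α.image_inter s t).superset ⟨hy, hys⟩
  exact ⟨x, hx, hxs, h⟩

/-- The map `α_t : A_{t⁻¹} → A` as a homomorphism of C*-algebras. -/
def actHom (t : G) : α.domAlg t⁻¹ →⋆ₙₐ[ℂ] A where
  toFun x := α.act t x
  map_smul' c x := α.map_smul t c x x.2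
  map_zero' := by simpa using α.map_smul t 0 0 (α.dom t⁻¹).zero_mem
  map_add' x y := α.map_add t x y x.2 y.2
  map_mul' x y := α.map_mul t x y x.2 y.2
  map_star' x := α.map_star t x x.2

lemma norm_act {t : G} {x : A} (hx : x ∈ α.dom t⁻¹) : ‖α.act t x‖ = ‖x‖ := by
  have : IsClosed (α.domAlg t⁻¹ : Set A) := α.isClosed_dom t⁻¹
  have hinj : Function.Injective (α.actHom t) :=
    fun x y h => Subtype.ext ((α.bijOn t).injOn x.2 y.2 h)
  exact NonUnitalStarAlgHom.norm_map (α.actHom t) hinj (⟨x, hx⟩ : α.domAlg t⁻¹)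

lemma act_sub {t : G} {x y : A} (hx : x ∈ α.dom t⁻¹) (hy : y ∈ α.dom t⁻¹) :
    α.act t (x - y) = α.act t x - α.act t y :=
  map_sub (α.actHom t) ⟨x, hx⟩ ⟨y, hy⟩

lemma tendsto_act {ι : Type*} {l : Filter ι} {t : G} {f : ι → A} {x : A}
    (hf : ∀ i, f i ∈ α.dom t⁻¹) (hx : x ∈ α.dom t⁻¹) (h : Tendsto f l (𝓝 x)) :
    Tendsto (fun i => α.act t (f i)) l (𝓝 (α.act t x)) := by
  rw [tendsto_iff_norm_sub_tendsto_zero] at h ⊢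
  refine h.congr fun i => ?_
  rw [← α.act_sub (hf i) hx, α.norm_act ((α.dom t⁻¹).sub_mem (hf i) hx)]

/-- `x = β_t(a) b` in every enveloping action `β` of `α`, expressed in terms of `α` only. -/
structure IsActMul (t : G) (a b x : A) : Prop where
  mem : x ∈ α.dom t
  act_mul : ∀ v ∈ α.dom t⁻¹, α.act t v * x = α.act t (v * a) * b

namespace IsActMul

variable {α} {s t r : G} {a a' b b' c x x' y z : A}

/-- The difference `d` lies in `A_t`, so `d⋆ = α_t(v)` for some `v`. The defining identity for this
`v` gives `d⋆ d = 0`. -/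
lemma unique (h : α.IsActMul t a b x) (h' : α.IsActMul t a b y) : x = y := by
  have hd := (α.dom t).sub_mem h.mem h'.mem
  obtain ⟨v, hv, hvd⟩ := α.exists_act_eq (α.star_mem_dom hd)
  rw [← sub_eq_zero, ← CStarRing.star_mul_self_eq_zero_iff, ← hvd, mul_sub, h.act_mul v hv,
    h'.act_mul v hv, sub_self]

/-- Testing with `α_t(v) = x⋆` bounds `‖x‖²` by `‖x‖ ‖a‖ ‖b‖`, because `α_t` is isometric. -/
lemma norm_le (h : α.IsActMul t a b x) : ‖x‖ ≤ ‖a‖ * ‖b‖ := by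
  obtain ⟨v, hv, hvx⟩ := α.exists_act_eq (α.star_mem_dom h.mem)
  have h1 : ‖x‖ * ‖x‖ ≤ ‖x‖ * (‖a‖ * ‖b‖) := by
    calc ‖x‖ * ‖x‖ = ‖α.act t (v * a) * b‖ := by
          rw [← CStarRing.norm_star_mul_self, ← hvx, h.act_mul v hv]
      _ ≤ ‖α.act t (v * a)‖ * ‖b‖ := norm_mul_le _ _
      _ ≤ ‖v‖ * ‖a‖ * ‖b‖ := by
          rw [α.norm_act (α.mul_mem_right _ _ _ hv)]
          gcongr
          exact norm_mul_le _ _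
      _ = ‖x‖ * (‖a‖ * ‖b‖) := by
          rw [← α.norm_act hv, hvx, norm_star, mul_assoc]
  rcases (norm_nonneg x).eq_or_lt with h0 | h0
  · rw [← h0]; positivity
  · exact le_of_mul_le_mul_left h1 h0

lemma add_left (h : α.IsActMul t a b x) (h' : α.IsActMul t a' b x') :
    α.IsActMul t (a + a') b (x + x') where
  mem := (α.dom t).add_mem h.mem h'.mem
  act_mul v hv := by
    rw [mul_add, mul_add, α.map_add _ _ _ (α.mul_mem_right _ _ _ hv) (α.mul_mem_right _ _ _ hv),
      add_mul, h.act_mul v hv, h'.act_mul v hv]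

lemma smul_left (k : ℂ) (h : α.IsActMul t a b x) : α.IsActMul t (k • a) b (k • x) where
  mem := (α.dom t).smul_mem k h.mem
  act_mul v hv := by
    rw [mul_smul_comm, mul_smul_comm, α.map_smul _ _ _ (α.mul_mem_right _ _ _ hv),
      smul_mul_assoc, h.act_mul v hv]

lemma add_right (h : α.IsActMul t a b x) (h' : α.IsActMul t a b' x') :
    α.IsActMul t a (b + b') (x + x') where
  mem := (α.dom t).add_mem h.mem h'.mem
  act_mul v hv := by rw [mul_add, mul_add, h.act_mul v hv, h'.act_mul v hv]

lemma smul_right (k : ℂ) (h : α.IsActMul t a b x) : α.IsActMul t a (k • b) (k • x) where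
  mem := (α.dom t).smul_mem k h.mem
  act_mul v hv := by rw [mul_smul_comm, mul_smul_comm, h.act_mul v hv]

lemma mul_right (c : A) (h : α.IsActMul t a b x) : α.IsActMul t a (b * c) (x * c) where
  mem := α.mul_mem_right _ _ _ h.mem
  act_mul v hv := by rw [← mul_assoc, ← mul_assoc, h.act_mul v hv]

lemma one (a b : A) : α.IsActMul 1 a b (a * b) where
  mem := by rw [α.dom_one]; trivial
  act_mul v _ := by rw [α.act_one, α.act_one, mul_assoc]

lemma act_right (a : A) (hy : y ∈ α.dom t⁻¹) :
    α.IsActMul t a (α.act t y) (α.act t (a * y)) where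
  mem := α.act_mem (α.mul_mem_left _ _ _ hy)
  act_mul v hv := by
    rw [← α.map_mul _ _ _ hv (α.mul_mem_left _ _ _ hy),
      ← α.map_mul _ _ _ (α.mul_mem_right _ _ _ hv) hy, mul_assoc]

/-- This is `(c β_t(a)) b = c (β_t(a) b)`, where `c β_t(a)` is read as `(β_t(a⋆) c⋆)⋆`. It is the
centrality condition that makes `β_t(a)` a multiplier. Writing `b α_t(v) = α_t(y)`, both sides times
`α_t(v)` equal `c α_t(a y)`. -/
lemma star_mul_eq (h : α.IsActMul t a b x) (h' : α.IsActMul t (star a) (star c) x') :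
    star x' * b = c * x := by
  have hd : star x' * b - c * x ∈ α.dom t :=
    (α.dom t).sub_mem (α.mul_mem_right _ _ _ (α.star_mem_dom h'.mem)) (α.mul_mem_left _ _ _ h.mem)
  obtain ⟨v, hv, hvd⟩ := α.exists_act_eq (α.star_mem_dom hd)
  obtain ⟨y, hy, hyv⟩ := α.exists_act_eq (α.mul_mem_left t b _ (α.act_mem hv))
  have h1 : x * α.act t v = α.act t (a * y) := by
    have := h.mul_right (α.act t v)
    rw [← hyv] at this
    exact this.unique (act_right a hy)
  have h2 : star x' * α.act t y = c * α.act t (a * y) := by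
    have := congrArg star (h'.act_mul _ (α.star_mem_dom hy))
    rwa [← star_mul, α.map_star _ _ hy, α.map_star _ _ (α.mul_mem_left _ _ _ hy), star_mul,
      star_mul, star_star, star_star, star_star] at this
  rw [← sub_eq_zero, ← CStarRing.mul_star_self_eq_zero_iff, ← hvd, sub_mul, mul_assoc, ← hyv, h2,
    mul_assoc, h1, sub_self]

/-- With `x⋆ = α_s(v)` one has `x⋆ x = α_s(v y) c`, and `v y` lies in `A_{s⁻¹} ∩ A_r`, which `α_s`
maps into `A_{sr}`. -/
lemma mem_mul (hy : y ∈ α.dom r) (h : α.IsActMul s y c x) : x ∈ α.dom (s * r) := by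
  obtain ⟨v, hv, hvx⟩ := α.exists_act_eq (α.star_mem_dom h.mem)
  refine α.mem_dom_of_star_mul_self_mem ?_
  rw [← hvx, h.act_mul v hv]
  exact α.mul_mem_right _ _ _ (α.act_mem_mul (α.mul_mem_right _ _ _ hv) (α.mul_mem_left _ _ _ hy))

/-- The composition law for `α_{sr}` holds only on `A_{(sr)⁻¹} ∩ A_{r⁻¹}`, so one wants to test only
there. This suffices: the error term lies in `A_{sr} ∩ A_s`, the image of that intersection under
`α_{sr}`, and is therefore annihilated by its own adjoint. -/
lemma of_mem_inter (hxs : x ∈ α.dom s) (hx : x ∈ α.dom (s * r))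
    (hc : ∀ v ∈ α.dom (s * r)⁻¹, α.act (s * r) (v * b) * c ∈ α.dom s)
    (h : ∀ w ∈ α.dom (s * r)⁻¹, w ∈ α.dom r⁻¹ →
      α.act (s * r) w * x = α.act (s * r) (w * b) * c) :
    α.IsActMul (s * r) b c x where
  mem := hx
  act_mul v hv := by
    have hd : α.act (s * r) v * x - α.act (s * r) (v * b) * c ∈ α.dom (s * r) :=
      (α.dom _).sub_mem (α.mul_mem_left _ _ _ hx)
        (α.mul_mem_right _ _ _ (α.act_mem (α.mul_mem_right _ _ _ hv)))
    have hd' : α.act (s * r) v * x - α.act (s * r) (v * b) * c ∈ α.dom (s * r * r⁻¹) := by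
      rw [mul_inv_cancel_right]
      exact (α.dom _).sub_mem (α.mul_mem_left _ _ _ hxs) (hc v hv)
    obtain ⟨w, hw, hwr, hwd⟩ :=
      α.exists_act_eq_of_mem_mul (α.star_mem_dom hd) (α.star_mem_dom hd')
    rw [← sub_eq_zero, ← CStarRing.star_mul_self_eq_zero_iff, ← hwd, mul_sub, ← mul_assoc,
      ← mul_assoc, ← α.map_mul _ _ _ hw hv, ← α.map_mul _ _ _ hw (α.mul_mem_right _ _ _ hv),
      h _ (α.mul_mem_left _ _ _ hv) (α.mul_mem_right _ _ _ hwr), mul_assoc, sub_self]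

/-- `β_s(β_r(b) a) c = β_{sr}(b) (β_s(a) c)`. -/
lemma comp (hy : α.IsActMul r b a y) (hx : α.IsActMul s y c x) (hz : α.IsActMul s a c z) :
    α.IsActMul (s * r) b z x := by
  refine of_mem_inter hx.mem (hx.mem_mul hy.mem) (fun v _ => α.mul_mem_left _ _ _ hz.mem)
    fun w hw hwr => ?_
  have hw' : w ∈ α.dom (r⁻¹ * s⁻¹) := by rwa [← mul_inv_rev]
  have hs : ∀ w ∈ α.dom (s * r)⁻¹, w ∈ α.dom r⁻¹ → α.act r w ∈ α.dom s⁻¹ := by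
    intro w hw hwr
    simpa using α.act_mem_mul hwr hw
  have hwb := α.mul_mem_right _ b _ hwr
  -- The chain is `α_s(α_r(w)) x = α_s(α_r(w) y) c = α_s(α_r(w b) a) c = α_s(α_r(w b)) z`.
  rw [α.act_mul s r w hw' hwr, α.act_mul s r _ (α.mul_mem_right _ _ _ hw') hwb,
    hx.act_mul _ (hs w hw hwr), hy.act_mul w hwr, hz.act_mul _ (hs _ (α.mul_mem_right _ _ _ hw) hwb)]

/-- `β_s(α_r(b)) c = β_{sr}(b) c`. -/
lemma of_act_left (hb : b ∈ α.dom r⁻¹) (hx : α.IsActMul s (α.act r b) c x) :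
    α.IsActMul (s * r) b c x := by
  refine of_mem_inter hx.mem (hx.mem_mul (α.act_mem hb)) (fun v hv => ?_) fun w hw hwr => ?_
  · have := α.act_mem_mul (α.mul_mem_right _ b _ hv) (α.mul_mem_left _ v _ hb)
    rw [mul_inv_cancel_right] at this
    exact α.mul_mem_right _ _ _ this
  · have hw' : w ∈ α.dom (r⁻¹ * s⁻¹) := by rwa [← mul_inv_rev]
    have hs : α.act r w ∈ α.dom s⁻¹ := by simpa using α.act_mem_mul hwr hw
    rw [α.act_mul s r w hw' hwr,
      α.act_mul s r _ (α.mul_mem_right _ _ _ hw') (α.mul_mem_left _ _ _ hb),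
      hx.act_mul _ hs, α.map_mul _ _ _ hwr hb]

end IsActMul

/-! ### Property (NS) and enveloping families in terms of these products. -/

variable {α}

/-- The product is the limit of `α_t(u_i a) b`: multiplying by `α_t(v)` gives `α_t(v u_i a) b`,
which tends to `α_t(v a) b`. Conversely, if `x = α_t(y)` is the product, then `α_t(u_i a) b =
α_t(u_i) x = α_t(u_i y)` tends to `x`. -/
lemma propertyNS_iff : α.PropertyNS ↔ ∀ t a b, ∃ x, α.IsActMul t a b x := by
  constructor
  · intro h t a b
    obtain ⟨ι, _, _, _, u, hu⟩ :=
      (α.domAlg t⁻¹).exists_isApproxUnit (α.isClosed_dom t⁻¹)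
    have hu : IsApproxUnit (α.dom t⁻¹) u := hu
    obtain ⟨x, hx⟩ := h a b t ι u hu
    have hmem : ∀ i, u i * a ∈ α.dom t⁻¹ := fun i => α.mul_mem_right _ _ _ (hu.mem i)
    refine ⟨x, (α.isClosed_dom t).mem_of_tendsto hx (Eventually.of_forall fun i =>
      α.mul_mem_right _ _ _ (α.act_mem (hmem i))), fun v hv => ?_⟩
    have h1 : Tendsto (fun i => α.act t (v * u i * a) * b) atTop (𝓝 (α.act t (v * a) * b)) :=
      (α.tendsto_act (fun i => α.mul_mem_right _ _ _ (α.mul_mem_right _ _ _ hv))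
        (α.mul_mem_right _ _ _ hv) ((hu.tendsto_mul_left v hv).mul_const a)).mul_const b
    refine tendsto_nhds_unique (hx.const_mul (α.act t v)) (h1.congr fun i => ?_)
    rw [mul_assoc, α.map_mul _ _ _ hv (hmem i), mul_assoc]
  · intro h a b t ι _ _ _ u hu
    obtain ⟨x, hx⟩ := h t a b
    obtain ⟨y, hy, hyx⟩ := α.exists_act_eq hx.mem
    refine ⟨x, ?_⟩
    have h1 := α.tendsto_act (fun i => α.mul_mem_left _ (u i) _ hy) hy (hu.tendsto_mul_right y hy)
    rw [hyx] at h1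
    refine h1.congr fun i => ?_
    rw [α.map_mul _ _ _ (hu.mem i) hy, hyx, hx.act_mul _ (hu.mem i)]

/-- The axioms give `α_t(v) F_t(a, b) = α_t(F_{t⁻¹}(α_t(v), a)) b`, and `F_{t⁻¹}(α_t(v), a) = F_1(v,
a) = v a`. -/
lemma IsEnvelopingFamily.isActMul {F : G → A →ₗ[ℂ] A →ₗ[ℂ] A} (hF : α.IsEnvelopingFamily F)
    (t : G) (a b : A) : α.IsActMul t a b (F t a b) where
  mem := hF.mem_dom t a b
  act_mul v hv := by
    rw [hF.mul_apply, ← hF.apply_act t⁻¹ t v a hv, inv_mul_cancel, hF.one_eq_mul]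

/-- The bilinear maps `(a, b) ↦ β_t(a) b`. -/
noncomputable def actMul (h : ∀ t a b, ∃ x, α.IsActMul t a b x) (t : G) : A →ₗ[ℂ] A →ₗ[ℂ] A :=
  LinearMap.mk₂ ℂ (fun a b => (h t a b).choose)
    (fun a a' b => (h t _ b).choose_spec.unique
      ((h t a b).choose_spec.add_left (h t a' b).choose_spec))
    (fun k a b => (h t _ b).choose_spec.unique ((h t a b).choose_spec.smul_left k))
    (fun a b b' => (h t a _).choose_spec.unique
      ((h t a b).choose_spec.add_right (h t a b').choose_spec))
    (fun k a b => (h t a _).choose_spec.unique ((h t a b).choose_spec.smul_right k))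

lemma isActMul_actMul (h : ∀ t a b, ∃ x, α.IsActMul t a b x) (t : G) (a b : A) :
    α.IsActMul t a b (actMul h t a b) :=
  (h t a b).choose_spec

end CStarPartialAction

/-! ### Global actions and their continuity. -/

namespace CStarPartialAction

section ofHom

variable {G : Type*} [Group G] {B : Type*} [NonUnitalCStarAlgebra B]

/-- The global action given by a homomorphism from `G` to the endomorphisms of `B`. -/
def ofHom (σ : G → B →⋆ₙₐ[ℂ] B) (h1 : ∀ x, σ 1 x = x)
    (hmul : ∀ s t x, σ (s * t) x = σ s (σ t x)) : CStarPartialAction G B where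
  dom _ := ⊤
  act t := σ t
  mul_mem_left _ _ _ _ := trivial
  mul_mem_right _ _ _ _ := trivial
  isClosed_dom _ := isClosed_univ
  bijOn t := by
    rw [Submodule.top_coe, Set.bijOn_univ]
    exact ⟨Function.LeftInverse.injective (g := σ t⁻¹) fun x => by
        rw [← hmul, inv_mul_cancel, h1],
      Function.RightInverse.surjective (g := σ t⁻¹) fun x => by
        rw [← hmul, mul_inv_cancel, h1]⟩
  dom_one := rfl
  act_one := h1
  image_inter s t := by
    simp only [Submodule.top_coe, Set.inter_self, Set.image_univ]
    exact Set.range_eq_univ.2 (Function.RightInverse.surjective (g := σ t⁻¹) fun x => by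
        rw [← hmul, mul_inv_cancel, h1])
  act_mul s t x _ _ := hmul s t x
  map_add t x y _ _ := _root_.map_add (σ t) x y
  map_smul t c x _ := _root_.map_smul (σ t) c x
  map_mul t x y _ _ := _root_.map_mul (σ t) x y
  map_star t x _ := StarHomClass.map_star (σ t) x

lemma ofHom_isGlobal (σ : G → B →⋆ₙₐ[ℂ] B) (h1 : ∀ x, σ 1 x = x)
    (hmul : ∀ s t x, σ (s * t) x = σ s (σ t x)) : (ofHom σ h1 hmul).IsGlobal :=
  fun _ => rfl

variable [TopologicalSpace G] [IsTopologicalGroup G]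

/-- A global action is continuous if it is strongly continuous at the identity on a set that is
invariant under the action and has dense span. -/
lemma IsGlobal.isContinuous {β : CStarPartialAction G B} (hβ : β.IsGlobal) {S : Set B}
    (hS : Dense (Submodule.span ℂ S : Set B))
    (h : ∀ b ∈ S, Tendsto (fun t => β.act t b) (𝓝 1) (𝓝 b)) : β.IsContinuous := by
  have hmem : ∀ t x, x ∈ β.dom t := fun t x => by rw [hβ t]; trivial
  have hspan : ∀ b ∈ Submodule.span ℂ S, Tendsto (fun t => β.act t b) (𝓝 1) (𝓝 b) := by
    intro b hb
    induction hb using Submodule.span_induction with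
    | mem b hb => exact h b hb
    | zero =>
      refine tendsto_const_nhds.congr fun t => ?_
      simpa using (β.map_smul t 0 0 (hmem _ _)).symm
    | add x y _ _ hx hy =>
      exact (hx.add hy).congr fun t => (β.map_add t x y (hmem _ _) (hmem _ _)).symm
    | smul c x _ hx => exact (hx.const_smul c).congr fun t => (β.map_smul t c x (hmem _ _)).symm
  have hall : ∀ b, Tendsto (fun t => β.act t b) (𝓝 1) (𝓝 b) := by
    intro b
    rw [Metric.tendsto_nhds]
    intro ε hε
    obtain ⟨c, hc, hbc⟩ := Metric.mem_closure_iff.1 (hS b) (ε / 3) (by positivity)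
    filter_upwards [Metric.tendsto_nhds.1 (hspan c hc) (ε / 3) (by positivity)] with t ht
    have h1 : dist (β.act t b) (β.act t c) = dist b c := by
      rw [dist_eq_norm, ← β.act_sub (hmem _ _) (hmem _ _), β.norm_act (hmem _ _), dist_eq_norm]
    have := dist_triangle4 (β.act t b) (β.act t c) c b
    rw [h1, dist_comm c b] at this
    linarith
  rintro ⟨s, b⟩ -
  refine ContinuousAt.continuousWithinAt ?_
  change Tendsto _ _ _
  have h1 : Tendsto (fun p : G × B => β.act (s⁻¹ * p.1) b) (𝓝 (s, b)) (𝓝 b) := by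
    refine (hall b).comp ?_
    have : Continuous fun p : G × B => s⁻¹ * p.1 := by fun_prop
    simpa using this.tendsto (s, b)
  have h2 : Tendsto (fun p : G × B => p.2) (𝓝 (s, b)) (𝓝 b) := continuous_snd.tendsto (s, b)
  rw [tendsto_iff_norm_sub_tendsto_zero] at h1 h2 ⊢
  refine squeeze_zero (fun _ => norm_nonneg _) (fun p => ?_) (by simpa using h2.add h1)
  -- Both summands are controlled by isometry of the action: the first by `‖p.2 - b‖`, the second by
  -- continuity at the identity.
  have e1 : β.act p.1 p.2 - β.act s b
      = β.act p.1 (p.2 - b) + β.act s (β.act (s⁻¹ * p.1) b - b) := by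
    rw [β.act_sub (hmem _ _) (hmem _ _), β.act_sub (hmem _ _) (hmem _ _),
      ← β.act_mul s _ b (hmem _ _) (hmem _ _), mul_inv_cancel_left]
    abel
  change ‖β.act p.1 p.2 - β.act s b‖ ≤ _
  rw [e1]
  refine (norm_add_le _ _).trans_eq ?_
  rw [β.norm_act (hmem _ _), β.norm_act (hmem _ _)]

end ofHom

/-! ### The C*-algebra generated by the translates of an embedded copy of `A`. -/

section Orbit

variable {G A M : Type*} [NonUnitalCStarAlgebra A] [NonUnitalCStarAlgebra M]

/-- The set `⋃ t, σ_t(π(A))`. -/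
def orbit (σ : G → M →⋆ₙₐ[ℂ] M) (π : A →⋆ₙₐ[ℂ] M) : Set M := ⋃ t, σ t '' Set.range π

variable {σ : G → M →⋆ₙₐ[ℂ] M} {π : A →⋆ₙₐ[ℂ] M}

lemma mem_orbit (t : G) (a : A) : σ t (π a) ∈ orbit σ π :=
  Set.mem_iUnion.2 ⟨t, π a, ⟨a, rfl⟩, rfl⟩

lemma exists_of_mem_orbit {x : M} (hx : x ∈ orbit σ π) : ∃ t a, σ t (π a) = x := by
  obtain ⟨t, _, ⟨a, rfl⟩, h⟩ := Set.mem_iUnion.1 hx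
  exact ⟨t, a, h⟩

variable [Group G]

lemma map_mem_span_orbit (hmul : ∀ s t x, σ (s * t) x = σ s (σ t x)) (t : G) {x : M}
    (hx : x ∈ Submodule.span ℂ (orbit σ π)) : σ t x ∈ Submodule.span ℂ (orbit σ π) := by
  induction hx using Submodule.span_induction with
  | mem x hx =>
    obtain ⟨s, a, rfl⟩ := exists_of_mem_orbit hx
    rw [← hmul]
    exact Submodule.subset_span (mem_orbit _ _)
  | zero => simp
  | add x y _ _ hx hy => rw [_root_.map_add]; exact add_mem hx hy
  | smul c x _ hx => rw [_root_.map_smul]; exact Submodule.smul_mem _ _ hx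

/-- The linear span of `⋃ t, σ_t(π(A))` as a *-subalgebra. -/
def orbitSpan (hmul : ∀ s t x, σ (s * t) x = σ s (σ t x))
    (hπ : ∀ t a c, σ t (π a) * π c ∈ Set.range π) : NonUnitalStarSubalgebra ℂ M where
  __ := Submodule.span ℂ (orbit σ π)
  mul_mem' := by
    intro x y hx hy
    change x * y ∈ Submodule.span ℂ (orbit σ π)
    induction hx, hy using Submodule.span_induction₂ with
    | mem_mem x y hx hy =>
      obtain ⟨s, a, rfl⟩ := exists_of_mem_orbit hx
      obtain ⟨t, c, rfl⟩ := exists_of_mem_orbit hy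
      obtain ⟨d, hd⟩ := hπ (t⁻¹ * s) a c
      -- The left side is `σ_t(σ_{t⁻¹s}(π a) π c)`, so a product of two generators is a single
      -- generator.
      have : σ s (π a) * σ t (π c) = σ t (π d) := by
        rw [hd, _root_.map_mul, ← hmul, mul_inv_cancel_left]
      rw [this]
      exact Submodule.subset_span (mem_orbit _ _)
    | zero_left y _ => simp
    | zero_right x _ => simp
    | add_left x y z _ _ _ hx hy => rw [add_mul]; exact add_mem hx hy
    | add_right x y z _ _ _ hx hy => rw [mul_add]; exact add_mem hx hy
    | smul_left c x y _ _ h => rw [smul_mul_assoc]; exact Submodule.smul_mem _ _ h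
    | smul_right c x y _ _ h => rw [mul_smul_comm]; exact Submodule.smul_mem _ _ h
  star_mem' := by
    intro x hx
    change star x ∈ Submodule.span ℂ (orbit σ π)
    induction hx using Submodule.span_induction with
    | mem x hx =>
      obtain ⟨s, a, rfl⟩ := exists_of_mem_orbit hx
      rw [← StarHomClass.map_star, ← StarHomClass.map_star]
      exact Submodule.subset_span (mem_orbit _ _)
    | zero => simp
    | add x y _ _ hx hy => rw [star_add]; exact add_mem hx hy
    | smul c x _ hx => rw [star_smul]; exact Submodule.smul_mem _ _ hx

variable (hmul : ∀ s t x, σ (s * t) x = σ s (σ t x))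
  (hπ : ∀ t a c, σ t (π a) * π c ∈ Set.range π)

/-- The C*-subalgebra generated by `⋃ t, σ_t(π(A))`. -/
def orbitAlg : NonUnitalStarSubalgebra ℂ M := (orbitSpan hmul hπ).topologicalClosure

instance orbitAlg_isClosed : IsClosed (orbitAlg hmul hπ : Set M) :=
  NonUnitalStarSubalgebra.isClosed_topologicalClosure _

lemma coe_orbitAlg :
    (orbitAlg hmul hπ : Set M) = closure (Submodule.span ℂ (orbit σ π) : Set M) := rfl

lemma map_mem_orbitAlg (t : G) {x : M} (hx : x ∈ orbitAlg hmul hπ) : σ t x ∈ orbitAlg hmul hπ := by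
  rw [← SetLike.mem_coe, coe_orbitAlg] at hx ⊢
  have hc : Continuous (σ t) := AddMonoidHomClass.continuous_of_bound (σ t) 1 fun x => by
    simpa using NonUnitalStarAlgHom.norm_apply_le (σ t) x
  exact map_mem_closure hc hx fun y hy => map_mem_span_orbit hmul t hy

/-- The endomorphism `σ_t` restricted to `orbitAlg`. -/
def orbitHom (t : G) : orbitAlg hmul hπ →⋆ₙₐ[ℂ] orbitAlg hmul hπ :=
  NonUnitalStarAlgHom.codRestrict
    ((σ t).comp (NonUnitalStarSubalgebraClass.subtype (orbitAlg hmul hπ))) _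
    fun x => map_mem_orbitAlg hmul hπ t x.2

variable (h1 : ∀ x, σ 1 x = x)

/-- The embedding `π` with codomain `orbitAlg`. -/
def orbitIncl : A →⋆ₙₐ[ℂ] orbitAlg hmul hπ :=
  NonUnitalStarAlgHom.codRestrict π _ fun a => by
    rw [← h1 (π a), ← SetLike.mem_coe, coe_orbitAlg]
    exact subset_closure (Submodule.subset_span (mem_orbit _ _))

/-- An injective *-homomorphism is isometric, so the range of `π` is closed and the ideal property
passes from generators to the closure of their span. -/
lemma mul_mem_range_of_mem_orbitAlg (hinj : Function.Injective π) {x : M}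
    (hx : x ∈ orbitAlg hmul hπ) (a : A) : x * π a ∈ Set.range π := by
  have hcl : IsClosed (Set.range π) :=
    (NonUnitalStarAlgHom.isometry π hinj).isClosedEmbedding.isClosed_range
  have hsub : closure (Submodule.span ℂ (orbit σ π) : Set M) ⊆ {x | x * π a ∈ Set.range π} := by
    refine closure_minimal (fun x hx => ?_) (hcl.preimage (continuous_mul_const (π a)))
    change x * π a ∈ Set.range π
    induction hx using Submodule.span_induction with
    | mem x hx =>
      obtain ⟨s, c, rfl⟩ := exists_of_mem_orbit hx
      exact hπ s c a
    | zero => exact ⟨0, by simp⟩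
    | add x y _ _ hx hy =>
      obtain ⟨c, hc⟩ := hx
      obtain ⟨d, hd⟩ := hy
      exact ⟨c + d, by rw [_root_.map_add, hc, hd, add_mul]⟩
    | smul k x _ hx =>
      obtain ⟨c, hc⟩ := hx
      exact ⟨k • c, by rw [_root_.map_smul, hc, smul_mul_assoc]⟩
  exact hsub hx

variable (α : CStarPartialAction G A)

/-- The action of `G` on `orbitAlg`. -/
noncomputable def orbitAction : CStarPartialAction G (orbitAlg hmul hπ) :=
  ofHom (orbitHom hmul hπ) (fun x => Subtype.ext (h1 x)) fun s t x => Subtype.ext (hmul s t x)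

lemma isCStarEnvelopingPair_orbitAction (hinj : Function.Injective π)
    (hdom : ∀ t, π '' (α.dom t) = Set.range π ∩ σ t '' Set.range π)
    (hact : ∀ t, ∀ a ∈ α.dom t⁻¹, π (α.act t a) = σ t (π a)) :
    α.IsCStarEnvelopingPair (orbitIncl hmul hπ h1) (orbitAction hmul hπ h1) where
  isGlobal := ofHom_isGlobal _ _ _
  injective x y h := hinj (congrArg Subtype.val h)
  mul_mem_left b a := by
    obtain ⟨c, hc⟩ := mul_mem_range_of_mem_orbitAlg hmul hπ hinj b.2 a
    exact ⟨c, Subtype.ext hc⟩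
  mul_mem_right b a := by
    obtain ⟨c, hc⟩ := mul_mem_range_of_mem_orbitAlg hmul hπ hinj (star b).2 (star a)
    refine ⟨star c, Subtype.ext ?_⟩
    change π (star c) = π a * (b : M)
    rw [StarHomClass.map_star, hc, star_mul, StarHomClass.map_star, star_star]
    simp
  image_dom t := by
    have hS : Function.Injective (Set.image ((↑) : orbitAlg hmul hπ → M)) :=
      Set.image_injective.2 Subtype.val_injective
    apply hS
    have hr : (↑) '' Set.range (orbitIncl hmul hπ h1) = Set.range π := by
      rw [← Set.range_comp]; rfl
    have hr' : (↑) '' ((orbitAction hmul hπ h1).act t '' Set.range (orbitIncl hmul hπ h1))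
        = σ t '' Set.range π := by
      rw [← hr, Set.image_image, Set.image_image]; rfl
    rw [Set.image_inter Subtype.val_injective, hr, hr', ← hdom t, Set.image_image]
    rfl
  map_act t a ha := Subtype.ext (hact t a ha)
  dense_span := by
    intro b
    rw [closure_subtype]
    have hb := b.2
    rw [← SetLike.mem_coe, coe_orbitAlg] at hb
    refine closure_mono ?_ hb
    have hle : Submodule.span ℂ (orbit σ π) ≤ (Submodule.span ℂ
        (⋃ t : G, (orbitAction hmul hπ h1).act t '' Set.range (orbitIncl hmul hπ h1))).map
        (orbitAlg hmul hπ).toSubmodule.subtype := by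
      rw [Submodule.span_le]
      intro x hx
      obtain ⟨t, a, rfl⟩ := exists_of_mem_orbit hx
      exact ⟨(orbitAction hmul hπ h1).act t (orbitIncl hmul hπ h1 a),
        Submodule.subset_span (Set.mem_iUnion.2 ⟨t, _, ⟨a, rfl⟩, rfl⟩), rfl⟩
    exact hle

variable [TopologicalSpace G] [IsTopologicalGroup G]

/-- The action of an enveloping pair is continuous if it is strongly continuous at the identity on
the range of the embedding. -/
lemma IsCStarEnvelopingPair.isContinuous {α : CStarPartialAction G A} {μ : A →⋆ₙₐ[ℂ] M}
    {β : CStarPartialAction G M} (hμ : α.IsCStarEnvelopingPair μ β)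
    (h : ∀ a, Tendsto (fun t => β.act t (μ a)) (𝓝 1) (𝓝 (μ a))) : β.IsContinuous := by
  have hmem : ∀ t x, x ∈ β.dom t := fun t x => by rw [hμ.isGlobal t]; trivial
  refine hμ.isGlobal.isContinuous hμ.dense_span fun b hb => ?_
  obtain ⟨s, _, ⟨a, rfl⟩, rfl⟩ := Set.mem_iUnion.1 hb
  -- Since `β_t β_s = β_s β_{s⁻¹ts}`, continuity at `β_s(μ a)` reduces to continuity at `μ a`.
  have h1 : Tendsto (fun t : G => s⁻¹ * t * s) (𝓝 1) (𝓝 1) := by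
    have : Continuous fun t : G => s⁻¹ * t * s := by fun_prop
    simpa using this.tendsto 1
  refine (β.tendsto_act (fun _ => hmem _ _) (hmem _ _) ((h a).comp h1)).congr fun t => ?_
  simp only [Function.comp]
  rw [← β.act_mul _ _ _ (hmem _ _) (hmem _ _), ← β.act_mul _ _ _ (hmem _ _) (hmem _ _)]
  congr 1
  group

end Orbit

end CStarPartialAction

/-! ### The model: bounded functions on `G` with values in the multiplier algebra. -/

open scoped MultiplierAlgebra ENNReal

lemma DoubleCentralizer.ext_of_fst {A : Type*} [NonUnitalCStarAlgebra A] {x y : 𝓜(ℂ, A)}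
    (h : ∀ b, x.fst b = y.fst b) : x = y := by
  rw [← sub_eq_zero, ← norm_eq_zero, ← DoubleCentralizer.norm_fst, DoubleCentralizer.sub_fst,
    norm_eq_zero, sub_eq_zero]
  exact ContinuousLinearMap.ext h

/-- Right translation by `t` on the bounded functions on `G`. -/
def lpTranslate {G E : Type*} [Group G] [NonUnitalCStarAlgebra E] (t : G) :
    lp (fun _ : G => E) ∞ →⋆ₙₐ[ℂ] lp (fun _ : G => E) ∞ where
  toFun f := ⟨fun r => f (r * t), memℓp_infty ⟨‖f‖, by
    rintro _ ⟨r, rfl⟩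
    exact lp.norm_apply_le_norm ENNReal.top_ne_zero f (r * t)⟩⟩
  map_smul' _ _ := rfl
  map_zero' := rfl
  map_add' _ _ := rfl
  map_mul' _ _ := rfl
  map_star' _ := rfl

lemma lpTranslate_apply {G E : Type*} [Group G] [NonUnitalCStarAlgebra E] (t : G)
    (f : lp (fun _ : G => E) ∞) (r : G) : lpTranslate t f r = f (r * t) := rfl

lemma lpTranslate_one {G E : Type*} [Group G] [NonUnitalCStarAlgebra E]
    (f : lp (fun _ : G => E) ∞) : lpTranslate 1 f = f := by
  ext r : 2
  rw [lpTranslate_apply, mul_one]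

lemma lpTranslate_mul {G E : Type*} [Group G] [NonUnitalCStarAlgebra E] (s t : G)
    (f : lp (fun _ : G => E) ∞) : lpTranslate (s * t) f = lpTranslate s (lpTranslate t f) := by
  ext r : 2
  simp only [lpTranslate_apply, mul_assoc]

namespace CStarPartialAction

variable {G : Type u} [Group G] {A : Type v} [NonUnitalCStarAlgebra A]
  {α : CStarPartialAction G A}

section Multiplier

variable (h : ∀ t a b, ∃ x, α.IsActMul t a b x)

/-- `β_t(a)` as a multiplier of `A`. -/
noncomputable def actMultiplier (t : G) (a : A) : 𝓜(ℂ, A) where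
  fst := (actMul h t a).mkContinuous ‖a‖ fun b => (isActMul_actMul h t a b).norm_le
  -- Right multiplication by `β_t(a)`, in the form `c ↦ (β_t(a⋆) c⋆)⋆`.
  snd := (((starₗᵢ ℂ : A ≃ₗᵢ⋆[ℂ] A) : A →L⋆[ℂ] A).comp
      ((actMul h t (star a)).mkContinuous ‖star a‖
        fun b => (isActMul_actMul h t (star a) b).norm_le)).comp
      ((starₗᵢ ℂ : A ≃ₗᵢ⋆[ℂ] A) : A →L⋆[ℂ] A)
  central c b := (isActMul_actMul h t a b).star_mul_eq (isActMul_actMul h t (star a) (star c))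

lemma actMultiplier_fst (t : G) (a b : A) : (actMultiplier h t a).fst b = actMul h t a b := rfl

lemma norm_actMultiplier_le (t : G) (a : A) : ‖actMultiplier h t a‖ ≤ ‖a‖ := by
  rw [← DoubleCentralizer.norm_fst]
  exact (actMul h t a).mkContinuous_norm_le (norm_nonneg a)
    fun b => (isActMul_actMul h t a b).norm_le

lemma actMul_comp (s r : G) (a b c : A) :
    actMul h s (actMul h r b a) c = actMul h (s * r) b (actMul h s a c) :=
  ((isActMul_actMul h r b a).comp (isActMul_actMul h s _ c) (isActMul_actMul h s a c)).unique
    (isActMul_actMul h (s * r) b _)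

lemma actMul_one (a b : A) : actMul h 1 a b = a * b :=
  (isActMul_actMul h 1 a b).unique (IsActMul.one a b)

lemma actMul_act (s r : G) {b : A} (hb : b ∈ α.dom r⁻¹) (c : A) :
    actMul h s (α.act r b) c = actMul h (s * r) b c :=
  (IsActMul.of_act_left hb (isActMul_actMul h s _ c)).unique (isActMul_actMul h (s * r) b c)

/-- The homomorphism `a ↦ (r ↦ β_r(a))` from `A` to the bounded functions from `G` to the
multiplier algebra of `A`. -/
noncomputable def envelopingHom : A →⋆ₙₐ[ℂ] lp (fun _ : G => 𝓜(ℂ, A)) ∞ where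
  toFun a := ⟨fun r => actMultiplier h r a, memℓp_infty ⟨‖a‖, by
    rintro _ ⟨r, rfl⟩
    exact norm_actMultiplier_le h r a⟩⟩
  map_smul' k a := by
    ext r : 2
    refine DoubleCentralizer.ext_of_fst fun b => ?_
    change actMul h r (k • a) b = k • actMul h r a b
    rw [_root_.map_smul, LinearMap.smul_apply]
  map_zero' := by
    ext r : 2
    refine DoubleCentralizer.ext_of_fst fun b => ?_
    change actMul h r 0 b = 0
    rw [map_zero, LinearMap.zero_apply]
  map_add' a a' := by
    ext r : 2
    refine DoubleCentralizer.ext_of_fst fun b => ?_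
    change actMul h r (a + a') b = actMul h r a b + actMul h r a' b
    rw [_root_.map_add, LinearMap.add_apply]
  map_mul' a a' := by
    ext r : 2
    refine DoubleCentralizer.ext_of_fst fun b => ?_
    change actMul h r (a * a') b = actMul h r a (actMul h r a' b)
    rw [← actMul_one h, actMul_comp, mul_one]
  map_star' a := by
    ext r : 2
    refine DoubleCentralizer.ext_of_fst fun b => ?_
    change actMul h r (star a) b = star (star (actMul h r (star a) (star (star b))))
    rw [star_star, star_star]

lemma envelopingHom_apply (a : A) (r : G) : envelopingHom h a r = actMultiplier h r a := rfl

lemma envelopingHom_injective : Function.Injective (envelopingHom h) := by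
  rw [injective_iff_map_eq_zero]
  intro a ha
  have h1 : (envelopingHom h a 1).fst (star a) = 0 := by rw [ha]; rfl
  rw [envelopingHom_apply, actMultiplier_fst, actMul_one] at h1
  exact CStarRing.mul_star_self_eq_zero_iff a |>.1 h1

/-- At `r` this reads `β_{rt}(a) β_r(c) = β_r(β_t(a) c)`, the associativity law. It makes the image
of `A` an ideal in the algebra generated by its translates. -/
lemma translate_mul_envelopingHom (t : G) (a c : A) :
    lpTranslate t (envelopingHom h a) * envelopingHom h c = envelopingHom h (actMul h t a c) := by
  ext r : 2
  refine DoubleCentralizer.ext_of_fst fun b => ?_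
  exact (actMul_comp h r t c a b).symm

lemma envelopingHom_act (t : G) {a : A} (ha : a ∈ α.dom t⁻¹) :
    envelopingHom h (α.act t a) = lpTranslate t (envelopingHom h a) := by
  ext r : 2
  refine DoubleCentralizer.ext_of_fst fun b => ?_
  exact actMul_act h r t ha b

lemma envelopingHom_image_dom (t : G) : envelopingHom h '' (α.dom t)
    = Set.range (envelopingHom h) ∩ lpTranslate t '' Set.range (envelopingHom h) := by
  refine Set.Subset.antisymm ?_ ?_
  · rintro _ ⟨a, ha, rfl⟩
    obtain ⟨b, hb, rfl⟩ := α.exists_act_eq ha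
    exact ⟨⟨_, rfl⟩, _, ⟨b, rfl⟩, (envelopingHom_act h t hb).symm⟩
  · rintro _ ⟨⟨a, rfl⟩, _, ⟨b, rfl⟩, hab⟩
    refine ⟨a, ?_, rfl⟩
    -- Evaluation at the identity gives `β_t(b) = a` as multipliers. Applied to `a⋆`, this shows `a
    -- a⋆ ∈ A_t`, which forces `a ∈ A_t`.
    have h1 : lpTranslate t (envelopingHom h b) 1 = envelopingHom h a 1 := by rw [hab]
    rw [lpTranslate_apply, one_mul, envelopingHom_apply, envelopingHom_apply] at h1
    have h2 : actMul h t b (star a) = a * star a := by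
      rw [← actMul_one h, ← actMultiplier_fst, h1, actMultiplier_fst]
    rw [← star_star a]
    refine α.star_mem_dom (α.mem_dom_of_star_mul_self_mem ?_)
    rw [star_star, ← h2]
    exact (isActMul_actMul h t b _).mem

lemma translate_mul_mem_range (t : G) (a c : A) :
    lpTranslate t (envelopingHom h a) * envelopingHom h c ∈ Set.range (envelopingHom h) :=
  ⟨_, (translate_mul_envelopingHom h t a c).symm⟩

/-- The enveloping C*-algebra. -/
def EnvelopingAlg : Type (max u v) :=
  orbitAlg (σ := lpTranslate) (π := envelopingHom h) lpTranslate_mul (translate_mul_mem_range h)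

noncomputable instance : NonUnitalCStarAlgebra (EnvelopingAlg h) :=
  NonUnitalStarSubalgebra.nonUnitalCStarAlgebra
    (h_closed := orbitAlg_isClosed lpTranslate_mul (translate_mul_mem_range h)) _

/-- The enveloping action. -/
noncomputable def envelopingAction : CStarPartialAction G (EnvelopingAlg h) :=
  orbitAction lpTranslate_mul (translate_mul_mem_range h) lpTranslate_one

/-- The embedding of `A` into its enveloping C*-algebra. -/
noncomputable def envelopingIncl : A →⋆ₙₐ[ℂ] EnvelopingAlg h :=
  orbitIncl lpTranslate_mul (translate_mul_mem_range h) lpTranslate_one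

lemma isCStarEnvelopingPair_envelopingAction :
    α.IsCStarEnvelopingPair (envelopingIncl h) (envelopingAction h) :=
  isCStarEnvelopingPair_orbitAction _ _ _ α (envelopingHom_injective h)
    (envelopingHom_image_dom h) fun t _ ha => envelopingHom_act h t ha

/-- The norm of the model is the supremum over `r` of multiplier norms, that is, of operator norms
over the unit ball of `A`. This is the quantity in condition 2. -/
lemma norm_envelopingAction_sub_le {ε : ℝ} (hε : 0 ≤ ε) (t : G) (a : A)
    (ht : ∀ r b, ‖b‖ ≤ 1 → ‖actMul h (r * t) a b - actMul h r a b‖ ≤ ε) :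
    ‖(envelopingAction h).act t (envelopingIncl h a) - envelopingIncl h a‖ ≤ ε := by
  change ‖lpTranslate t (envelopingHom h a) - envelopingHom h a‖ ≤ ε
  refine lp.norm_le_of_forall_le hε fun r => ?_
  change ‖actMultiplier h (r * t) a - actMultiplier h r a‖ ≤ ε
  rw [← DoubleCentralizer.norm_fst]
  exact ContinuousLinearMap.opNorm_le_of_unit_norm hε fun b hb => ht r b hb.le

end Multiplier

/-! ### Arbitrary enveloping pairs, and the theorem. -/

namespace IsCStarEnvelopingPair

variable {B : Type*} [NonUnitalCStarAlgebra B] {μ : A →⋆ₙₐ[ℂ] B} {β : CStarPartialAction G B}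
  (hμ : α.IsCStarEnvelopingPair μ β)

include hμ

lemma mem_dom (t : G) (x : B) : x ∈ β.dom t := by rw [hμ.isGlobal t]; trivial

lemma act_mul (t : G) (x y : B) : β.act t (x * y) = β.act t x * β.act t y :=
  β.map_mul t x y (hμ.mem_dom _ _) (hμ.mem_dom _ _)

lemma act_act (s t : G) (x : B) : β.act s (β.act t x) = β.act (s * t) x :=
  (β.act_mul s t x (hμ.mem_dom _ _) (hμ.mem_dom _ _)).symm

lemma exists_isActMul (t : G) (a b : A) :
    ∃ x, α.IsActMul t a b x ∧ μ x = β.act t (μ a) * μ b := by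
  have hx : β.act t (μ a) * μ b ∈ μ '' (α.dom t) := by
    rw [hμ.image_dom]
    refine ⟨hμ.mul_mem_left _ _, μ a * β.act t⁻¹ (μ b), hμ.mul_mem_right _ _, ?_⟩
    rw [hμ.act_mul, hμ.act_act, mul_inv_cancel, β.act_one]
  obtain ⟨x, hxt, hx⟩ := hx
  refine ⟨x, ⟨hxt, fun v hv => hμ.injective ?_⟩, hx⟩
  rw [_root_.map_mul, _root_.map_mul, hx, hμ.map_act t v hv,
    hμ.map_act t _ (α.mul_mem_right _ _ _ hv), _root_.map_mul, hμ.act_mul, mul_assoc]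

lemma map_isActMul {t : G} {a b x : A} (h : α.IsActMul t a b x) :
    μ x = β.act t (μ a) * μ b := by
  obtain ⟨y, hy, hμy⟩ := hμ.exists_isActMul t a b
  rw [h.unique hy, hμy]

lemma propertyNS : α.PropertyNS :=
  propertyNS_iff.2 fun t a b => (hμ.exists_isActMul t a b).imp fun _ h => h.1

/-- The maps `(a, b) ↦ β_t(a) b` form an enveloping family. -/
lemma isEnvelopingFamily (h : ∀ t a b, ∃ x, α.IsActMul t a b x) :
    α.IsEnvelopingFamily (actMul h) := by
  have hF : ∀ t a b, μ (actMul h t a b) = β.act t (μ a) * μ b :=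
    fun t a b => hμ.map_isActMul (isActMul_actMul h t a b)
  have hmem : ∀ t a b, actMul h t a b ∈ α.dom t := fun t a b => (isActMul_actMul h t a b).mem
  -- The companion formula: `α_t(F_{t⁻¹}(a, b))` represents `a β_t(b)`. With it the axioms become
  -- associativity and multiplicativity in `B`.
  have hR : ∀ t a b, μ (α.act t (actMul h t⁻¹ a b)) = μ a * β.act t (μ b) := by
    intro t a b
    rw [hμ.map_act t _ (hmem _ _ _), hF, hμ.act_mul, hμ.act_act, mul_inv_cancel, β.act_one]
  refine ⟨hmem, actMul_one h, ?_, ?_, ?_, ?_, ?_, ?_, ?_, ?_, ?_⟩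
  · intro t a b c
    apply hμ.injective
    rw [_root_.map_mul μ, hF, hF, _root_.map_mul, mul_assoc]
  · intro t a b c
    apply hμ.injective
    rw [_root_.map_mul μ, hR, hR, _root_.map_mul, mul_assoc]
  · intro t a b c
    apply hμ.injective
    rw [_root_.map_mul, _root_.map_mul, hR, hF, mul_assoc]
  · intro s t a b c
    exact actMul_comp h t s b a c
  · intro s t a b c
    apply hμ.injective
    have := hR s⁻¹ a b
    rw [inv_inv] at this
    rw [hF, this, hF, hF, hμ.act_mul, hμ.act_act, mul_assoc]
  · intro a
    refine ⟨?_, fun H => ?_⟩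
    · rintro rfl
      simp
    · have := (H 1 (star a)).1
      rw [actMul_one] at this
      exact CStarRing.mul_star_self_eq_zero_iff a |>.1 this
  · intro s t a b ha
    exact (actMul_act h s t ha b).symm
  · intro s t a b ha
    apply hμ.injective
    rw [hR, ← mul_inv_rev, hR, hμ.map_act t a ha, hμ.act_act]
  · intro t a b H
    -- The case `s = 1`, `c = a⋆` already gives `a a⋆ = F_t(b, a⋆) ∈ A_t`.
    have h1 := (H 1 (star a)).1
    rw [actMul_one, one_mul] at h1
    rw [← star_star a]
    refine α.star_mem_dom (α.mem_dom_of_star_mul_self_mem ?_)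
    rw [star_star, h1]
    exact hmem _ _ _

end IsCStarEnvelopingPair

theorem PropertyNS.existsUnique_isEnvelopingFamily (h : α.PropertyNS) :
    ∃! F : G → A →ₗ[ℂ] A →ₗ[ℂ] A, α.IsEnvelopingFamily F := by
  have h' := propertyNS_iff.1 h
  refine ⟨actMul h', (isCStarEnvelopingPair_envelopingAction h').isEnvelopingFamily h', ?_⟩
  intro F hF
  funext t
  ext a b
  exact (hF.isActMul t a b).unique (isActMul_actMul h' t a b)

end CStarPartialAction

open CStarPartialAction

theorem mainTheorem2 {G : Type u} [Group G] [TopologicalSpace G] [IsTopologicalGroup G]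
    [LocallyCompactSpace G] [T2Space G] {A : Type v} [NonUnitalCStarAlgebra A]
    (α : CStarPartialAction G A) (hα : α.IsContinuous) :
    (α.PropertyNS → ∃! F : G → A →ₗ[ℂ] A →ₗ[ℂ] A, α.IsEnvelopingFamily F) ∧
    (α.HasCStarEnvelopingPair ↔
      α.PropertyNS ∧
      ∀ F : G → A →ₗ[ℂ] A →ₗ[ℂ] A, α.IsEnvelopingFamily F →
        ∀ a : A, Tendsto
          (fun t : G => ⨆ (r : G) (b : A) (_ : ‖b‖ ≤ 1), ‖F (r * t) a b - F r a b‖ₑ)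
          (𝓝 1) (𝓝 0)) := by
  refine ⟨PropertyNS.existsUnique_isEnvelopingFamily, ?_, ?_⟩
  · rintro ⟨B, _, μ, β, hβ, hμ⟩
    refine ⟨hμ.propertyNS, fun F hF a => ?_⟩
    have hlim : Tendsto (fun t : G => ‖β.act t (μ a) - μ a‖ₑ) (𝓝 1) (𝓝 0) := by
      have h1 : ContinuousWithinAt (fun p : G × B => β.act p.1 p.2) _ ((1 : G), μ a) :=
        hβ (1, μ a) (hμ.mem_dom _ _)
      have huniv : {p : G × B | p.2 ∈ β.dom p.1⁻¹} = Set.univ :=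
        Set.eq_univ_of_forall fun p => hμ.mem_dom _ _
      rw [huniv, continuousWithinAt_univ] at h1
      have h2 : Tendsto (fun t : G => β.act t (μ a)) (𝓝 1) (𝓝 (μ a)) := by
        have h3 : Tendsto (fun t : G => (t, μ a)) (𝓝 1) (𝓝 ((1 : G), μ a)) :=
          (Continuous.prodMk_left (μ a)).tendsto 1
        have h4 := h1.tendsto.comp h3
        rwa [β.act_one] at h4
      have h5 := (h2.sub_const (μ a)).enorm
      simpa using h5
    refine tendsto_of_tendsto_of_tendsto_of_le_of_le tendsto_const_nhds hlim
      (fun _ => zero_le) fun t => ?_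
    refine iSup_le fun r => iSup_le fun b => iSup_le fun hb => ?_
    rw [enorm_le_iff_norm_le]
    -- Factoring out the isometry `β_r` makes the estimate uniform in `r`.
    have hmap : μ (F (r * t) a b - F r a b) = β.act r (β.act t (μ a) - μ a) * μ b := by
      rw [map_sub, hμ.map_isActMul (hF.isActMul _ a b), hμ.map_isActMul (hF.isActMul _ a b),
        β.act_sub (hμ.mem_dom _ _) (hμ.mem_dom _ _), hμ.act_act, sub_mul]
    rw [← NonUnitalStarAlgHom.norm_map μ hμ.injective, hmap]
    refine (norm_mul_le _ _).trans ?_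
    rw [β.norm_act (hμ.mem_dom _ _), NonUnitalStarAlgHom.norm_map μ hμ.injective]
    exact mul_le_of_le_one_right (norm_nonneg _) hb
  · rintro ⟨hNS, hF⟩
    have h := propertyNS_iff.1 hNS
    have hpair := isCStarEnvelopingPair_envelopingAction h
    refine ⟨EnvelopingAlg h, inferInstance, envelopingIncl h, envelopingAction h,
      hpair.isContinuous fun a => ?_, hpair⟩
    rw [Metric.tendsto_nhds]
    intro ε hε
    -- Passing through the supremum yields only a weak inequality, and `ε / 2` restores strictness.
    have hε' : (0 : ℝ≥0∞) < ENNReal.ofReal (ε / 2) := by simpa using hε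
    filter_upwards [(hF _ (hpair.isEnvelopingFamily h) a).eventually (gt_mem_nhds hε')] with t ht
    rw [dist_eq_norm]
    refine (norm_envelopingAction_sub_le h (half_pos hε).le t a fun r b hb => ?_).trans_lt
      (half_lt_self hε)
    have h1 : ‖actMul h (r * t) a b - actMul h r a b‖ₑ ≤ ENNReal.ofReal (ε / 2) :=
      (le_iSup₂_of_le r b (by rw [iSup_pos hb])).trans ht.le
    rwa [← ofReal_norm, ENNReal.ofReal_le_ofReal_iff (half_pos hε).le] at h1
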